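/- Let $k=\mathbb F_q$ with $q$ odd, $q>3$, let $n\ge 0$, $A=M_{2n}(k)$, $J=\begin{pmatrix}0&I_n\\-I_n&0\end{pmatrix}\in A$, and let $a^\sim=Ja^{t}J^{-1}$, an involution of $A$. For any involution $*$ of $A$ and $\varepsilon=\pm1$ put $J_\varepsilon=\begin{pmatrix}0&1\\ \varepsilon&0\end{pmatrix}$, $SL^\varepsilon_*(2,A)=\{T\in GL_2(A): TJ_\varepsilon T^*=J_\varepsilon\}$, where $(T^*)_{ij}=(T_{ji})^*$, and $A^s=\{a\in A: a^*=-\varepsilon a\}$. This group contains $h_t=\begin{pmatrix}t&0\\0&(t^*)^{-1}\end{pmatrix}$ $(t\in A^\times)$, $w=\begin{pmatrix}0&1\\ \varepsilon&0\end{pmatrix}$ and $u_s=\begin{pmatrix}1&s\\0&1\end{pmatrix}$ $(s\in A^s)$. Let $G=SL^{-1}_\sim(2,M_{2n}(k))$ and let $G_0\le G$ be the subgroup generated by all $h_t$, $u_s$ and $w$. From here on $*={\sim}$ and $\varepsilon=-1$. Let $V=k^{2n}$ (row vectors), $[x,y]=x\cdot(yJ)$ with $\cdot$ the dot product, and let $M=V^2$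 be the right $A$-module with $(x,y)a=(xa,ya)$. For a nontrivial character $\psi:k\to\mathbb C^\times$ of the additive group of $k$ put $$\chi((x,y),(v,z))=\psi([x,z]-[y,v]),\quad \alpha=1,\quad \gamma(u,(x,y))=\psi([xu,y])\ (u\in A^s),\quad c=q^{-2n}.$$ Then: 1. $G$ is isomorphic to the split orthogonal group $O_q(2n,2n)=SL^{+1}_{t}(2,M_{2n}(k))$, where $t$ is the transposition. 2. For every nontrivial $\psi$ the data $(M,\chi,\alpha,\gamma,c)$ satisfy the Gutiérrez–Pantoja–Soto-Andrade axioms. That is, for all $x,y,z\in M$, $r\in A^\times$, $s,s'\in A^s$ and $t\in A^s\cap A^\times$: $\chi$ is bi-additive, $\chi(xr,y)=\alpha(rr^*)\chi(x,yr^*)$, $\chi(y,x)=\chi(-\varepsilon x,y)$, and only $y=0$ satisfies $\chi(x',y)=1$ for all $x'\in M$; $\gamma(s+s',x)=\gamma(s,x)\gamma(s',x)$, $\gamma(s,xr)=\gamma(rsr^*,x)$, $\gamma(t,x+z)=\gamma(t,x)\gamma(t,z)\chi(x,zt)$; $c^2|M|=\alpha(\varepsilon)$ and $\sum_{y\in M}\gamma(t,y)=\alpha(\varepsilon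 t)/c$. 3. For every nontrivial $\psi$ there is a generalized Weil representation of $G$ associated to these data, that is, a unitary representation $\rho$ of the whole group $G$ on $L^2(M)$ (for the counting measure) with $$\rho(h_t)f(x)=\overline{\alpha}(t)f(xt),\quad \rho(u_s)f(x)=\gamma(s,x)f(x),\quad \rho(w)f(x)=c\sum_{y\in M}\chi(-\varepsilon x,y)f(y).$$ Any two such representations for the same $\psi$ agree on $G_0$. 4. Up to isomorphism this does not depend on $\psi$. Let $\psi_1,\psi_2$ be nontrivial characters. For every generalized Weil representation $\rho_1$ of $G$ associated to $\psi_1$ there is one, $\rho_2$, associated to $\psi_2$ that is unitarily equivalent to $\rho_1$ as a representation of $G$. Moreover, for any generalized Weil representations $\rho_1,\rho_2$ associated to $\psi_1$ and $\psi_2$, the restrictions of $\rho_1$ and $\rho_2$ to $G_0$ are unitarily equivalent. -/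

import Mathlib

noncomputable section

namespace GenWeil

open Matrix

/-! ## Rings with involution -/

section Involution

variable {A : Type*} [Ring A] (σ : RingInvo A)

/-- The involution `a ↦ a*` as a map from `A` to itself. -/
def inv (a : A) : A := (σ a).unop

lemma inv_inv (a : A) : inv σ (inv σ a) = a := σ.involution a

lemma inv_mul (a b : A) : inv σ (a * b) = inv σ b * inv σ a := by
  simp [inv]

lemma inv_add (a b : A) : inv σ (a + b) = inv σ a + inv σ b := by
  simp [inv]

lemma inv_neg (a : A) : inv σ (-a) = -inv σ a := by
  simp [inv]

lemma inv_zero : inv σ (0 : A) = 0 := by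
  simp [inv]

lemma inv_one : inv σ (1 : A) = 1 := by
  simp [inv]

/-- The involution on units, `t ↦ t*`. -/
def invUnit (t : Aˣ) : Aˣ where
  val := inv σ t
  inv := inv σ ↑t⁻¹
  val_inv := by rw [← inv_mul, Units.inv_mul, inv_one]
  inv_val := by rw [← inv_mul, Units.mul_inv, inv_one]

variable (A) in
/-- The sign `ε = ±1` as a unit of `A`. -/
def sgn (ε : ℤˣ) : Aˣ := Units.map (Int.castRingHom A : ℤ →* A) ε

lemma sgn_cases (ε : ℤˣ) : (sgn A ε : A) = 1 ∨ (sgn A ε : A) = -1 := by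
  rcases Int.units_eq_one_or ε with rfl | rfl
  · left; simp [sgn]
  · right; simp [sgn]

/-- The `ε`-symmetric elements of `A`, that is, the `a` with `a* = -ε a`. -/
def symm (ε : ℤˣ) : AddSubgroup A where
  carrier := {a | inv σ a = -(sgn A ε * a)}
  zero_mem' := by simp [inv_zero]
  add_mem' := by
    intro a b ha hb
    simp only [Set.mem_ofPred_eq] at *
    rw [inv_add, ha, hb, mul_add, neg_add]
  neg_mem' := by
    intro a ha
    simp only [Set.mem_ofPred_eq] at *
    rw [inv_neg, ha, mul_neg]

variable {σ} in
/-- The element `r s r*` for `s` an `ε`-symmetric element. -/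
def conjSymm {ε : ℤˣ} (r : A) (s : symm σ ε) : symm σ ε :=
  ⟨r * s * inv σ r, by
    have hs : inv σ (s : A) = -(sgn A ε * s) := s.2
    change inv σ (r * s * inv σ r) = -(sgn A ε * (r * s * inv σ r))
    rw [inv_mul, inv_mul, inv_inv, hs]
    rcases sgn_cases (A := A) ε with h | h <;> simp [h, mul_assoc]⟩

/-- The extension of the involution to `2 × 2` matrices: `(T*) i j = (T j i)*`. -/
def matInv (T : Matrix (Fin 2) (Fin 2) A) : Matrix (Fin 2) (Fin 2) A :=
  Matrix.of fun i j => inv σ (T j i)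

lemma matInv_mul (S T : Matrix (Fin 2) (Fin 2) A) :
    matInv σ (S * T) = matInv σ T * matInv σ S := by
  ext i j
  simp [matInv, Matrix.mul_apply, Fin.sum_univ_two, inv_add, inv_mul]

lemma matInv_one : matInv σ (1 : Matrix (Fin 2) (Fin 2) A) = 1 := by
  ext i j
  fin_cases i <;> fin_cases j <;> simp [matInv, inv_one, inv_zero]

variable (A) in
/-- The matrix `J_ε`. -/
def formMat (ε : ℤˣ) : Matrix (Fin 2) (Fin 2) A := !![0, 1; (sgn A ε : A), 0]

/-- The group `SL_*^ε(2, A)` of the invertible `2 × 2` matrices `T` over `A` with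
`T J_ε T* = J_ε`. -/
def SLstar (ε : ℤˣ) : Subgroup (Matrix (Fin 2) (Fin 2) A)ˣ where
  carrier := {T | (T : Matrix (Fin 2) (Fin 2) A) * formMat A ε * matInv σ T = formMat A ε}
  one_mem' := by simp [matInv_one]
  mul_mem' := by
    intro S T hS hT
    simp only [Set.mem_ofPred_eq, Units.val_mul] at *
    calc (S * T : Matrix (Fin 2) (Fin 2) A) * formMat A ε * matInv σ (S * T)
        = S * (T * formMat A ε * matInv σ T) * matInv σ S := by
          rw [matInv_mul]; simp only [mul_assoc]
      _ = formMat A ε := by rw [hT, hS]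
  inv_mem' := by
    intro T hT
    simp only [Set.mem_ofPred_eq] at *
    have h1 : matInv σ (T : Matrix (Fin 2) (Fin 2) A) * matInv σ ↑T⁻¹ = 1 := by
      rw [← matInv_mul, Units.inv_mul, matInv_one]
    calc (↑T⁻¹ : Matrix (Fin 2) (Fin 2) A) * formMat A ε * matInv σ ↑T⁻¹
        = ↑T⁻¹ * (T * formMat A ε * matInv σ T) * matInv σ ↑T⁻¹ := by rw [hT]
      _ = (↑T⁻¹ * ↑T) * formMat A ε * (matInv σ T * matInv σ ↑T⁻¹) := by
          simp only [mul_assoc]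
      _ = formMat A ε := by rw [h1, Units.inv_mul, one_mul, mul_one]

/-- The element `h_t = diag(t, (t*)⁻¹)`. -/
def hElt (ε : ℤˣ) (t : Aˣ) : SLstar σ ε :=
  ⟨{ val := !![(t : A), 0; 0, ((invUnit σ t)⁻¹ : Aˣ)]
     inv := !![((t⁻¹ : Aˣ) : A), 0; 0, (invUnit σ t : A)]
     val_inv := by
       rw [Matrix.mul_fin_two, Matrix.one_fin_two]; simp
     inv_val := by
       rw [Matrix.mul_fin_two, Matrix.one_fin_two]; simp }, by
    have h1 : inv σ (((invUnit σ t)⁻¹ : Aˣ) : A) = (t⁻¹ : Aˣ) := inv_inv σ _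
    have h2 : inv σ (t : A) = invUnit σ t := rfl
    have h3 : matInv σ !![(t : A), 0; 0, ((invUnit σ t)⁻¹ : Aˣ)]
        = !![(invUnit σ t : A), 0; 0, (t⁻¹ : Aˣ)] := by
      ext i j
      fin_cases i <;> fin_cases j <;> simp [matInv, inv_zero, h1, h2]
    change !![(t : A), 0; 0, ((invUnit σ t)⁻¹ : Aˣ)] * formMat A ε * matInv σ _ = formMat A ε
    rw [h3, formMat, Matrix.mul_fin_two, Matrix.mul_fin_two]
    rcases sgn_cases (A := A) ε with h | h <;> simp [h]⟩

/-- The element `w = (0, 1; ε, 0)`. -/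
def wElt (ε : ℤˣ) : SLstar σ ε :=
  ⟨{ val := !![0, 1; (sgn A ε : A), 0]
     inv := !![0, (sgn A ε : A); 1, 0]
     val_inv := by
       rw [Matrix.mul_fin_two, Matrix.one_fin_two]
       rcases sgn_cases (A := A) ε with h | h <;> simp [h]
     inv_val := by
       rw [Matrix.mul_fin_two, Matrix.one_fin_two]
       rcases sgn_cases (A := A) ε with h | h <;> simp [h] }, by
    have h3 : matInv σ !![0, 1; (sgn A ε : A), 0] = !![0, (sgn A ε : A); 1, 0] := by
      ext i j
      rcases sgn_cases (A := A) ε with h | h <;>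
      fin_cases i <;> fin_cases j <;> simp [matInv, inv_zero, inv_one, inv_neg, h]
    change !![0, 1; (sgn A ε : A), 0] * formMat A ε * matInv σ _ = formMat A ε
    rw [h3, formMat, Matrix.mul_fin_two, Matrix.mul_fin_two]
    rcases sgn_cases (A := A) ε with h | h <;> simp [h]⟩

/-- The element `u_s = (1, s; 0, 1)`, for `s` an `ε`-symmetric element. -/
def uElt (ε : ℤˣ) (s : symm σ ε) : SLstar σ ε :=
  ⟨{ val := !![1, (s : A); 0, 1]
     inv := !![1, -(s : A); 0, 1]
     val_inv := by
       rw [Matrix.mul_fin_two, Matrix.one_fin_two]; simp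
     inv_val := by
       rw [Matrix.mul_fin_two, Matrix.one_fin_two]; simp }, by
    have hs : inv σ (s : A) = -(sgn A ε * s) := s.2
    have h3 : matInv σ !![1, (s : A); 0, 1] = !![1, 0; -(sgn A ε * (s : A)), 1] := by
      ext i j
      fin_cases i <;> fin_cases j <;> simp [matInv, inv_zero, inv_one, hs]
    change !![1, (s : A); 0, 1] * formMat A ε * matInv σ _ = formMat A ε
    rw [h3, formMat, Matrix.mul_fin_two, Matrix.mul_fin_two]
    rcases sgn_cases (A := A) ε with h | h <;> simp [h]⟩

/-- The subgroup of `SL_*^ε(2, A)` generated by the elements `h_t`, `u_s` and `w`. -/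
def bruhatSubgroup (ε : ℤˣ) : Subgroup (SLstar σ ε) :=
  Subgroup.closure (Set.range (hElt σ ε) ∪ Set.range (uElt σ ε) ∪ {wElt σ ε})

end Involution

/-! ## Data for a generalized Weil representation

A right `A`-module is a module over the opposite ring, and `x t` is `MulOpposite.op t • x`. -/

section Data

variable {A : Type*} [Ring A]

/-- The data `(χ, α, γ, c)` on a right `A`-module `M`, without any condition. -/
structure Data (σ : RingInvo A) (ε : ℤˣ) (M : Type*) where
  χ : M → M → ℂˣ
  α : Aˣ →* ℂˣ
  γ : symm σ ε → M → ℂˣ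
  c : ℂˣ

variable {σ : RingInvo A} {ε : ℤˣ} {M : Type*} [AddCommGroup M] [Module Aᵐᵒᵖ M] [Fintype M]

open MulOpposite (op)

/-- The axioms of Gutiérrez, Pantoja and Soto-Andrade. -/
structure Data.Axioms (D : Data σ ε M) : Prop where
  χ_add_left : ∀ x x' y, D.χ (x + x') y = D.χ x y * D.χ x' y
  χ_add_right : ∀ x y y', D.χ x (y + y') = D.χ x y * D.χ x y'
  χ_smul : ∀ (x y : M) (t : Aˣ),
    D.χ (op (t : A) • x) y = D.α (t * invUnit σ t) * D.χ x (op (inv σ (t : A)) • y)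
  χ_swap : ∀ x y : M, D.χ y x = D.χ (op (-(sgn A ε : A)) • x) y
  χ_nondeg : ∀ y : M, (∀ x : M, D.χ x y = 1) → y = 0
  γ_add : ∀ (s s' : symm σ ε) (x : M), D.γ (s + s') x = D.γ s x * D.γ s' x
  γ_smul : ∀ (s : symm σ ε) (x : M) (r : Aˣ),
    D.γ s (op (r : A) • x) = D.γ (conjSymm (r : A) s) x
  γ_quad : ∀ t : symm σ ε, IsUnit (t : A) → ∀ x z : M,
    D.γ t (x + z) = D.γ t x * D.γ t z * D.χ x (op (t : A) • z)
  c_sq : (D.c : ℂ) ^ 2 * Fintype.card M = D.α (sgn A ε)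
  gauss_sum : ∀ (t : Aˣ) (ht : (t : A) ∈ symm σ ε),
    ∑ y : M, (D.γ ⟨t, ht⟩ y : ℂ) = (D.α (sgn A ε * t) : ℂ) / D.c

/-- Unitary representations of `G` on `L²(M)`, for `M` with the counting measure. -/
abbrev UnitaryRep (G : Type*) [Group G] (M : Type*) [Fintype M] :=
  G →* (EuclideanSpace ℂ M ≃ₗᵢ[ℂ] EuclideanSpace ℂ M)

/-- The unitary representation `ρ` of `SL_*^ε(2, A)` on `L²(M)` is a generalized Weil
representation associated to the data `D`: the elements `h_t`, `u_s` and `w` act by the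
prescribed formulas. -/
structure IsGenWeilRep (D : Data σ ε M) (ρ : UnitaryRep (SLstar σ ε) M) : Prop where
  map_h : ∀ (t : Aˣ) (f : EuclideanSpace ℂ M) (x : M),
    ρ (hElt σ ε t) f x = starRingEnd ℂ (D.α t : ℂ) * f (op (t : A) • x)
  map_u : ∀ (s : symm σ ε) (f : EuclideanSpace ℂ M) (x : M),
    ρ (uElt σ ε s) f x = (D.γ s x : ℂ) * f x
  map_w : ∀ (f : EuclideanSpace ℂ M) (x : M),
    ρ (wElt σ ε) f x = (D.c : ℂ) * ∑ y : M, (D.χ (op (-(sgn A ε : A)) • x) y : ℂ) * f y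

end Data

/-! ## The data for the split orthogonal group -/

section Orthogonal

variable (k : Type*) [Field k] (n : ℕ)

/-- The ring `M_{2n}(k)`. -/
abbrev Mat : Type _ := Matrix (Fin n ⊕ Fin n) (Fin n ⊕ Fin n) k

/-- The space `V = k^{2n}` of row vectors, on which matrices act on the right (by Mathlib's
instance `op a • x = x ᵥ* a`). -/
abbrev RowVec : Type _ := Fin n ⊕ Fin n → k

/-- The matrix `J_{2n} = (0, I; -I, 0)`. -/
def J : Mat k n := Matrix.fromBlocks 0 1 (-1) 0

lemma J_mul_J : J k n * J k n = -1 := by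
  rw [J, Matrix.fromBlocks_multiply, ← Matrix.fromBlocks_one, Matrix.fromBlocks_neg]
  simp

/-- `J_{2n}` as an invertible matrix. -/
def JUnit : (Mat k n)ˣ where
  val := J k n
  inv := -J k n
  val_inv := by rw [mul_neg, J_mul_J, neg_neg]
  inv_val := by rw [neg_mul, J_mul_J, neg_neg]

lemma J_transpose : (J k n)ᵀ = -J k n := by
  simp [J, Matrix.fromBlocks_transpose, Matrix.fromBlocks_neg]

/-- Transposition of matrices, as an involution. -/
def transposeInvo : RingInvo (Mat k n) :=
  { Matrix.transposeRingEquiv (Fin n ⊕ Fin n) k with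
    involution' := fun x => by simp }

/-- The involution `a ↦ a~ = J_{2n} aᵀ J_{2n}⁻¹`. -/
def tilde : RingInvo (Mat k n) :=
  RingInvo.mk'
    { toFun := fun a => MulOpposite.op (J k n * aᵀ * ↑(JUnit k n)⁻¹)
      map_one' := by
        rw [Matrix.transpose_one, mul_one, ← MulOpposite.op_one]
        exact congrArg _ (JUnit k n).mul_inv
      map_zero' := by simp
      map_add' := fun a b => by
        rw [Matrix.transpose_add, mul_add, add_mul, MulOpposite.op_add]
      map_mul' := fun a b => by
        rw [← MulOpposite.op_mul, Matrix.transpose_mul]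
        congr 1
        have h : (↑(JUnit k n)⁻¹ : Mat k n) * J k n = 1 := (JUnit k n).inv_mul
        calc J k n * (bᵀ * aᵀ) * ↑(JUnit k n)⁻¹
            = J k n * bᵀ * 1 * aᵀ * ↑(JUnit k n)⁻¹ := by simp only [mul_assoc, one_mul]
          _ = _ := by rw [← h]; simp only [mul_assoc] }
    (fun a => by
      have h : ((JUnit k n)⁻¹ : (Mat k n)ˣ).val = -J k n := rfl
      change J k n * (J k n * aᵀ * ((JUnit k n)⁻¹ : (Mat k n)ˣ).val)ᵀ * ((JUnit k n)⁻¹ : (Mat k n)ˣ).val = a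
      rw [h, Matrix.transpose_mul, Matrix.transpose_mul, Matrix.transpose_transpose,
        Matrix.transpose_neg, J_transpose, neg_neg]
      calc J k n * (J k n * (a * -J k n)) * -J k n
          = (J k n * J k n) * a * (J k n * J k n) := by
            simp only [mul_neg, neg_mul, neg_neg, mul_assoc]
        _ = a := by rw [J_mul_J]; simp)

/-- The split orthogonal group `O_q(2n, 2n)`, that is `SL_⋄^+(2, M_{2n}(k))`: the block matrices
`T` of size `4n` with `T (0, I; I, 0) Tᵀ = (0, I; I, 0)`. -/
abbrev SplitOrthogonal : Type _ := SLstar (transposeInvo k n) 1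

/-- The same group seen as `SL_~^-(2, M_{2n}(k))`. -/
abbrev OGroup : Type _ := SLstar (tilde k n) (-1)

/-- The right module `M = V²`, with `(x, y) a = (x a, y a)`. -/
abbrev VSq : Type _ := RowVec k n × RowVec k n

variable {k n}

/-- The skew-symmetric form `[x, y] = ⟨x, y J_{2n}⟩`. -/
def br (x y : RowVec k n) : k := x ⬝ᵥ (y ᵥ* J k n)

/-- The data attached to a character `ψ` of the additive group of `k`. -/
def orthData [Fintype k] (ψ : AddChar k ℂˣ) : Data (tilde k n) (-1) (VSq k n) where
  χ p p' := ψ (br p.1 p'.2 - br p.2 p'.1)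
  α := 1
  γ u p := ψ (br (p.1 ᵥ* (u : Mat k n)) p.2)
  c := (Units.mk0 (Fintype.card k : ℂ) (Nat.cast_ne_zero.mpr Fintype.card_ne_zero)) ^ (-2 * n : ℤ)

end Orthogonal

end GenWeil

end

/-!
The group `G = SL_~^-(2, M_{2n}(k))` preserves `(0, J; -J, 0)`, a symmetric form of size `4n` to
which the block matrix `diag(1, -J)` carries the standard split form. Conjugation by this matrix
identifies the split orthogonal group with `G` (`nonempty_splitOrthogonal_mulEquiv`).

The axioms follow from the fact that `~` is the adjoint with respect to the form `[x, y]`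
(`br_vecMul_left`), so that `[xs, y]` is skew in `x` and `y` when `s~ = s`, together with the
orthogonality relation for the characters `ψ([x, ·])` (`sum_char_br`), which also evaluates the
Gauss sum.

For the existence of the Weil representation on the whole group no presentation of `G` is needed.
The group acts on the right on `V² = k^{4n}`, and hence unitarily on `L²(V²)`, by
`(T f)(p) = f(p T)`. The partial Fourier transform
`(F f)(x, η) = q⁻ⁿ ∑ y, ψ([η, y]) f(x, y)` is unitary, and `F⁻¹ T F` is a generalized Weil
representation: under `F` the prescribed operators for `h_t`, `u_s` and `w` become the substitutions
`(x, η) ↦ (xt, η(t~)⁻¹)`, `(x, η) ↦ (x, η + xs)` and `(x, η) ↦ (-η, x)`, which are right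
multiplications by these elements.

Finally, every nontrivial character is of the form `ψ₂(x) = ψ₁(a x)` with `a ≠ 0`, and the unitary
dilation `f(x, y) ↦ f(x, a y)` carries the operators prescribed for `ψ₁` to those prescribed
for `ψ₂`. It thus transports Weil representations of all of `G`; on the subgroup generated by
`h_t`, `u_s` and `w` the transported one agrees with any other one attached to `ψ₂`.
-/

noncomputable section

namespace GenWeil

open Matrix
open MulOpposite (op)
open scoped ComplexConjugate

/-! ### The symplectic form on row vectors -/

section Form

variable {k : Type*} [Field k] {n : ℕ}

lemma inv_tilde (a : Mat k n) : inv (tilde k n) a = J k n * aᵀ * -J k n := rfl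

lemma inv_transposeInvo (a : Mat k n) : inv (transposeInvo k n) a = aᵀ := rfl

lemma br_swap (x y : RowVec k n) : br y x = -br x y := by
  rw [br, br, dotProduct_comm, ← dotProduct_mulVec, ← vecMul_transpose, J_transpose, vecMul_neg,
    dotProduct_neg]

lemma br_add_left (x x' y : RowVec k n) : br (x + x') y = br x y + br x' y := by
  simp [br, add_dotProduct]

lemma br_add_right (x y y' : RowVec k n) : br x (y + y') = br x y + br x y' := by
  simp [br, add_vecMul, dotProduct_add]

lemma br_neg_right (x y : RowVec k n) : br x (-y) = -br x y := by
  simp [br, neg_vecMul]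

lemma br_smul_left (a : k) (x y : RowVec k n) : br (a • x) y = a * br x y := by
  simp [br]

lemma br_smul_right (a : k) (x y : RowVec k n) : br x (a • y) = a * br x y := by
  simp [br, smul_vecMul]

/-- The involution `~` is the adjoint with respect to the form. -/
lemma br_vecMul_left (a : Mat k n) (x y : RowVec k n) :
    br (x ᵥ* a) y = br x (y ᵥ* inv (tilde k n) a) := by
  have h : inv (tilde k n) a * J k n = J k n * aᵀ := by
    rw [inv_tilde, mul_assoc, neg_mul, J_mul_J, neg_neg, mul_one]
  rw [br, br, vecMul_vecMul, h, ← vecMul_vecMul, vecMul_transpose, dotProduct_mulVec]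

lemma br_vecMul_right (a : Mat k n) (x y : RowVec k n) :
    br x (y ᵥ* a) = br (x ᵥ* inv (tilde k n) a) y := by
  rw [br_vecMul_left, inv_inv]

lemma exists_br_eq {y : RowVec k n} (hy : y ≠ 0) (a : k) : ∃ x, br x y = a := by
  have hJ : y ᵥ* J k n ≠ 0 := by
    intro h
    apply hy
    have := congrArg (· ᵥ* J k n) h
    simpa [vecMul_vecMul, J_mul_J, vecMul_neg] using this
  obtain ⟨i, hi⟩ := Function.ne_iff.mp hJ
  exact ⟨Pi.single i (a / (y ᵥ* J k n) i), by
    rw [br, single_dotProduct, div_mul_cancel₀ _ hi]⟩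

end Form

/-! ### Character sums -/

section CharSum

variable {k : Type*} [Field k] {n : ℕ}

lemma exists_apply_ne_one {ψ : AddChar k ℂˣ} (hψ : ψ ≠ 1) : ∃ a, ψ a ≠ 1 := by
  simpa [AddChar.ext_iff] using hψ

variable [Fintype k]

open scoped Classical in
/-- Orthogonality of characters for the pairing `ψ([x, y])`. -/
lemma sum_char_br {ψ : AddChar k ℂˣ} (hψ : ψ ≠ 1) (y : RowVec k n) :
    ∑ x, (ψ (br x y) : ℂ) = if y = 0 then (Fintype.card k : ℂ) ^ (2 * n) else 0 := by
  split_ifs with hy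
  · subst hy
    simp [br, two_mul]
  · obtain ⟨a, ha⟩ := exists_apply_ne_one hψ
    obtain ⟨x₀, hx₀⟩ := exists_br_eq hy a
    -- translation by `x₀` multiplies the sum by `ψ a ≠ 1`
    have h : (ψ a : ℂ) * ∑ x, (ψ (br x y) : ℂ) = ∑ x, (ψ (br x y) : ℂ) := by
      rw [Finset.mul_sum, ← Equiv.sum_comp (Equiv.addLeft x₀) fun x => (ψ (br x y) : ℂ)]
      refine Finset.sum_congr rfl fun x _ => ?_
      rw [Equiv.coe_addLeft, br_add_left, hx₀, AddChar.map_add_eq_mul, Units.val_mul]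
    have h' : ((ψ a : ℂ) - 1) * ∑ x, (ψ (br x y) : ℂ) = 0 := by rw [sub_mul, h, one_mul, sub_self]
    exact (mul_eq_zero.mp h').resolve_left
      (sub_ne_zero.mpr fun h1 => ha (Units.ext h1))

open scoped Classical in
lemma sum_char_br_right {ψ : AddChar k ℂˣ} (hψ : ψ ≠ 1) (x : RowVec k n) :
    ∑ y, (ψ (br x y) : ℂ) = if x = 0 then (Fintype.card k : ℂ) ^ (2 * n) else 0 := by
  simp_rw [fun y => show br x y = br y (-x) by rw [br_neg_right, br_swap x y, neg_neg]]
  rw [sum_char_br hψ]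
  simp

lemma conj_char (ψ : AddChar k ℂˣ) (a : k) : conj (ψ a : ℂ) = ψ (-a) :=
  (((Units.coeHom ℂ).compAddChar ψ).map_neg_eq_conj a).symm

end CharSum

/-! ### The group is the split orthogonal group -/

section Isomorphism

variable (k : Type*) [Field k] (n : ℕ)

/-- The change of basis `diag(1, -J)`, which carries the form `(0, 1; 1, 0)` to
`(0, J; -J, 0)`. -/
def baseChange : (Matrix (Fin 2) (Fin 2) (Mat k n))ˣ where
  val := !![1, 0; 0, -J k n]
  inv := !![1, 0; 0, J k n]
  val_inv := by simp [Matrix.one_fin_two, J_mul_J]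
  inv_val := by simp [Matrix.one_fin_two, J_mul_J]

variable {k n}

lemma matInv_fin_two {A : Type*} [Ring A] (σ : RingInvo A) (T : Matrix (Fin 2) (Fin 2) A) :
    matInv σ T = !![inv σ (T 0 0), inv σ (T 1 0); inv σ (T 0 1), inv σ (T 1 1)] := by
  ext1 i j
  fin_cases i <;> fin_cases j <;> rfl

lemma matInv_tilde (T : Matrix (Fin 2) (Fin 2) (Mat k n)) :
    matInv (tilde k n) T =
      !![J k n, 0; 0, J k n] * matInv (transposeInvo k n) T * -!![J k n, 0; 0, J k n] := by
  ext1 i j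
  fin_cases i <;> fin_cases j <;>
    simp [matInv_fin_two, inv_tilde, inv_transposeInvo, Matrix.mul_apply, Fin.sum_univ_two]

/-- With `P = diag(1, -J)` and `Q = Pᵗ diag(-J, -J)`, the conjugate `T' = P T P⁻¹` satisfies
`T' (0, 1; -1, 0) T'~ = P (T (0, 1; 1, 0) Tᵗ) Q`, while `P (0, 1; 1, 0) Q = (0, 1; -1, 0)`. -/
lemma conj_baseChange_mem_iff (T : (Matrix (Fin 2) (Fin 2) (Mat k n))ˣ) :
    baseChange k n * T * (baseChange k n)⁻¹ ∈ SLstar (tilde k n) (-1) ↔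
      T ∈ SLstar (transposeInvo k n) 1 := by
  let Q : (Matrix (Fin 2) (Fin 2) (Mat k n))ˣ :=
    { val := !![-J k n, 0; 0, 1]
      inv := !![J k n, 0; 0, 1]
      val_inv := by simp [Matrix.one_fin_two, J_mul_J]
      inv_val := by simp [Matrix.one_fin_two, J_mul_J] }
  have hP : matInv (transposeInvo k n) (baseChange k n : Matrix (Fin 2) (Fin 2) (Mat k n)) *
      -!![J k n, 0; 0, J k n] = Q := by
    ext1 i j
    fin_cases i <;> fin_cases j <;>
      simp [Q, baseChange, matInv_fin_two, inv_transposeInvo, Matrix.mul_apply, Fin.sum_univ_two,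
        J_transpose, J_mul_J]
  have h₁ : matInv (tilde k n) (baseChange k n * T * (baseChange k n)⁻¹ :
      (Matrix (Fin 2) (Fin 2) (Mat k n))ˣ) = !![J k n, 0; 0, J k n] *
        matInv (transposeInvo k n) ((baseChange k n)⁻¹ : (Matrix (Fin 2) (Fin 2) (Mat k n))ˣ) *
        matInv (transposeInvo k n) T * Q := by
    rw [matInv_tilde, Units.val_mul, Units.val_mul, matInv_mul, matInv_mul, ← hP]
    simp only [mul_assoc]
  have h₂ : ((baseChange k n)⁻¹ : (Matrix (Fin 2) (Fin 2) (Mat k n))ˣ) * formMat (Mat k n) (-1) *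
      (!![J k n, 0; 0, J k n] *
        matInv (transposeInvo k n) ((baseChange k n)⁻¹ : (Matrix (Fin 2) (Fin 2) (Mat k n))ˣ)) =
      formMat (Mat k n) 1 := by
    change !![1, 0; 0, J k n] * formMat (Mat k n) (-1) *
      (!![J k n, 0; 0, J k n] * matInv (transposeInvo k n) !![1, 0; 0, J k n]) = _
    ext1 i j
    fin_cases i <;> fin_cases j <;>
      simp [matInv_fin_two, formMat, sgn, inv_transposeInvo, Matrix.mul_apply, Fin.sum_univ_two,
        J_transpose, J_mul_J]
  have h₃ : (baseChange k n : Matrix (Fin 2) (Fin 2) (Mat k n)) * formMat (Mat k n) 1 * Q =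
      formMat (Mat k n) (-1) := by
    ext1 i j
    fin_cases i <;> fin_cases j <;>
      simp [Q, baseChange, formMat, sgn, Matrix.mul_apply, Fin.sum_univ_two, J_mul_J]
  change (baseChange k n * T * (baseChange k n)⁻¹ : (Matrix (Fin 2) (Fin 2) (Mat k n))ˣ) *
    formMat (Mat k n) (-1) * matInv (tilde k n) (baseChange k n * T * (baseChange k n)⁻¹ :
      (Matrix (Fin 2) (Fin 2) (Mat k n))ˣ) = formMat (Mat k n) (-1) ↔
    (T : Matrix (Fin 2) (Fin 2) (Mat k n)) * formMat (Mat k n) 1 *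
      matInv (transposeInvo k n) T = formMat (Mat k n) 1
  have h₄ : (baseChange k n * T * (baseChange k n)⁻¹ : (Matrix (Fin 2) (Fin 2) (Mat k n))ˣ) *
      formMat (Mat k n) (-1) * matInv (tilde k n) (baseChange k n * T * (baseChange k n)⁻¹ :
        (Matrix (Fin 2) (Fin 2) (Mat k n))ˣ) =
      baseChange k n * (T * formMat (Mat k n) 1 * matInv (transposeInvo k n) T) * Q := by
    rw [h₁, ← h₂, Units.val_mul, Units.val_mul]
    simp only [mul_assoc]
  rw [h₄, ← h₃, Units.mul_left_inj, Units.mul_right_inj]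

variable (k n) in
lemma nonempty_splitOrthogonal_mulEquiv : Nonempty (SplitOrthogonal k n ≃* OGroup k n) := by
  have h : (SLstar (transposeInvo k n) 1).map (MulAut.conj (baseChange k n)).toMonoidHom =
      SLstar (tilde k n) (-1) := by
    ext T
    rw [Subgroup.mem_map_equiv, ← conj_baseChange_mem_iff, MulAut.conj_symm_apply]
    simp only [mul_assoc, mul_inv_cancel_left, mul_inv_cancel, mul_one]
  exact ⟨((MulAut.conj (baseChange k n)).subgroupMap _).trans (MulEquiv.subgroupCongr h)⟩

end Isomorphism

/-! ### The axioms -/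

section Axioms

variable {k : Type*} [Field k] [Fintype k] {n : ℕ}

omit [Fintype k] in
lemma inv_coe_symm (s : symm (tilde k n) (-1)) : inv (tilde k n) (s : Mat k n) = s := by
  have hs : inv (tilde k n) (s : Mat k n) = -(sgn (Mat k n) (-1) * s) := s.2
  rw [hs]
  simp [sgn]

omit [Fintype k] in
lemma op_neg_sgn_smul (p : VSq k n) : op (-(sgn (Mat k n) (-1) : Mat k n)) • p = p := by
  simp [sgn]

lemma orthData_c (ψ : AddChar k ℂˣ) :
    ((orthData (n := n) ψ).c : ℂ) = ((Fintype.card k : ℂ) ^ (2 * n))⁻¹ := by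
  rw [← zpow_natCast, ← _root_.zpow_neg]
  simp [orthData]

lemma orthData_axioms {ψ : AddChar k ℂˣ} (hψ : ψ ≠ 1) : (orthData (n := n) ψ).Axioms where
  χ_add_left x x' y := by
    simp only [orthData, ← AddChar.map_add_eq_mul, Prod.fst_add, Prod.snd_add, br_add_left]
    congr 1; ring
  χ_add_right x y y' := by
    simp only [orthData, ← AddChar.map_add_eq_mul, Prod.fst_add, Prod.snd_add, br_add_right]
    congr 1; ring
  χ_smul x y t := by
    simp [orthData, br_vecMul_left]
  χ_swap x y := by
    rw [op_neg_sgn_smul]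
    simp only [orthData]
    rw [br_swap x.2, br_swap x.1]
    congr 1; ring
  χ_nondeg y h := by
    obtain ⟨a, ha⟩ := exists_apply_ne_one hψ
    refine Prod.ext ?_ ?_
    · by_contra hy
      obtain ⟨x, hx⟩ := exists_br_eq hy (-a)
      have h0 : br (0 : RowVec k n) y.2 = 0 := zero_dotProduct _
      apply ha
      simpa [orthData, hx, h0] using h (0, x)
    · by_contra hy
      obtain ⟨x, hx⟩ := exists_br_eq hy a
      have h0 : br (0 : RowVec k n) y.1 = 0 := zero_dotProduct _
      apply ha
      simpa [orthData, hx, h0] using h (x, 0)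
  γ_add s s' x := by
    simp [orthData, vecMul_add, br_add_left, AddChar.map_add_eq_mul]
  γ_smul s x r := by
    simp [orthData, conjSymm, br_vecMul_right, vecMul_vecMul]
  γ_quad t _ x z := by
    simp only [orthData, ← AddChar.map_add_eq_mul, Prod.fst_add, Prod.snd_add, Prod.smul_fst,
      Prod.smul_snd]
    have h1 : br x.1 (op (t : Mat k n) • z.2) = br (x.1 ᵥ* (t : Mat k n)) z.2 := by
      rw [br_vecMul_left, inv_coe_symm]; rfl
    have h2 : br x.2 (op (t : Mat k n) • z.1) = -br (z.1 ᵥ* (t : Mat k n)) x.2 := by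
      rw [← br_swap]; rfl
    rw [h1, h2, add_vecMul, br_add_left, br_add_right, br_add_right]
    congr 1; ring
  c_sq := by
    have hq : (Fintype.card k : ℂ) ≠ 0 := Nat.cast_ne_zero.mpr Fintype.card_ne_zero
    have h : (Fintype.card (VSq k n) : ℂ) = ((Fintype.card k : ℂ) ^ (2 * n)) ^ 2 := by
      simp [sq, two_mul]
    rw [h, orthData_c, ← mul_pow, inv_mul_cancel₀ (pow_ne_zero _ hq)]
    simp [orthData]
  gauss_sum t ht := by
    classical
    have ht0 (x : RowVec k n) : x ᵥ* (t : Mat k n) = 0 ↔ x = 0 := by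
      refine ⟨fun h => ?_, fun h => by rw [h, zero_vecMul]⟩
      simpa [vecMul_vecMul] using congrArg (· ᵥ* ((t⁻¹ : (Mat k n)ˣ) : Mat k n)) h
    have hx (x : RowVec k n) : ∑ y, (ψ (br (x ᵥ* (t : Mat k n)) y) : ℂ) =
        if x = 0 then (Fintype.card k : ℂ) ^ (2 * n) else 0 := by
      rw [sum_char_br_right hψ]
      exact if_congr (ht0 x) rfl rfl
    calc ∑ p : VSq k n, (ψ (br (p.1 ᵥ* (t : Mat k n)) p.2) : ℂ)
        = ∑ x, ∑ y, (ψ (br (x ᵥ* (t : Mat k n)) y) : ℂ) := Fintype.sum_prod_type _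
      _ = (Fintype.card k : ℂ) ^ (2 * n) := by simp [hx]
      _ = _ := by
        rw [orthData_c]
        simp [orthData]

end Axioms

/-! ### The Weil representation -/

section Representation

variable {k : Type*} [Field k] {n : ℕ}

/-- Right multiplication of a row vector `(x, y)`, with `x` and `y` in `V`, by a `2 × 2` matrix
over `M_{2n}(k)`. -/
def rowMul (p : VSq k n) (T : Matrix (Fin 2) (Fin 2) (Mat k n)) : VSq k n :=
  (p.1 ᵥ* T 0 0 + p.2 ᵥ* T 1 0, p.1 ᵥ* T 0 1 + p.2 ᵥ* T 1 1)

lemma rowMul_one (p : VSq k n) : rowMul p 1 = p := by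
  simp [rowMul]

lemma rowMul_mul (p : VSq k n) (S T : Matrix (Fin 2) (Fin 2) (Mat k n)) :
    rowMul p (S * T) = rowMul (rowMul p S) T := by
  ext1 <;>
  · simp only [rowMul, Matrix.mul_apply, Fin.sum_univ_two, vecMul_add, add_vecMul, vecMul_vecMul]
    abel

/-- Right multiplication by an invertible matrix, as a permutation of `V²`. -/
def rowMulEquiv (T : (Matrix (Fin 2) (Fin 2) (Mat k n))ˣ) : VSq k n ≃ VSq k n where
  toFun p := rowMul p T
  invFun p := rowMul p ↑T⁻¹
  left_inv p := by beta_reduce; rw [← rowMul_mul, Units.mul_inv, rowMul_one]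
  right_inv p := by beta_reduce; rw [← rowMul_mul, Units.inv_mul, rowMul_one]

variable [Fintype k]

/-- The permutation representation `(T f)(p) = f(p T)` of the group on functions on `V²`. -/
def permRep : UnitaryRep (OGroup k n) (VSq k n) :=
  MonoidHom.mk'
    (fun T => LinearIsometryEquiv.piLpCongrLeft 2 ℂ ℂ (rowMulEquiv (T : (Matrix _ _ _)ˣ)).symm)
    fun S T => by
      ext f p
      change f (rowMul p _) = f (rowMul (rowMul p _) _)
      rw [← rowMul_mul]
      rfl

lemma permRep_apply (T : OGroup k n) (f : EuclideanSpace ℂ (VSq k n)) (p : VSq k n) :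
    permRep T f p = f (rowMul p ((T : (Matrix (Fin 2) (Fin 2) (Mat k n))ˣ) : Matrix _ _ _)) := rfl

/-- The Fourier transform in the second variable,
`(F f)(x, η) = q⁻ⁿ ∑ y, ψ([η, y]) f(x, y)`, as a linear map. -/
def partialFourierAux (ψ : AddChar k ℂˣ) :
    EuclideanSpace ℂ (VSq k n) →ₗ[ℂ] EuclideanSpace ℂ (VSq k n) where
  toFun f := WithLp.toLp 2 fun p =>
    ((Fintype.card k : ℂ) ^ n)⁻¹ * ∑ y, (ψ (br p.2 y) : ℂ) * f (p.1, y)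
  map_add' f g := by
    ext p
    simp [mul_add, Finset.sum_add_distrib]
  map_smul' a f := by
    ext p
    simp only [PiLp.smul_apply, smul_eq_mul, RingHom.id_apply, Finset.mul_sum]
    exact Finset.sum_congr rfl fun y _ => by ring

lemma partialFourierAux_apply (ψ : AddChar k ℂˣ) (f : EuclideanSpace ℂ (VSq k n)) (p : VSq k n) :
    partialFourierAux ψ f p =
      ((Fintype.card k : ℂ) ^ n)⁻¹ * ∑ y, (ψ (br p.2 y) : ℂ) * f (p.1, y) := rfl

/-- Plancherel's formula for the partial Fourier transform. -/
lemma inner_partialFourierAux {ψ : AddChar k ℂˣ} (hψ : ψ ≠ 1) (f g : EuclideanSpace ℂ (VSq k n)) :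
    inner ℂ (partialFourierAux ψ f) (partialFourierAux ψ g) = inner ℂ f g := by
  classical
  have hq : (Fintype.card k : ℂ) ≠ 0 := Nat.cast_ne_zero.mpr Fintype.card_ne_zero
  simp only [PiLp.inner_apply, RCLike.inner_apply, Fintype.sum_prod_type]
  refine Finset.sum_congr rfl fun x _ => ?_
  calc ∑ η, partialFourierAux ψ g (x, η) * conj (partialFourierAux ψ f (x, η))
      = ((Fintype.card k : ℂ) ^ (2 * n))⁻¹ * ∑ η, ∑ y, ∑ z,
          (ψ (br η (y - z)) : ℂ) * (g (x, y) * conj (f (x, z))) := by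
        rw [Finset.mul_sum]
        refine Finset.sum_congr rfl fun η _ => ?_
        simp only [partialFourierAux_apply, map_mul, map_sum, map_inv₀, map_pow, map_natCast,
          conj_char]
        rw [mul_mul_mul_comm, Finset.sum_mul_sum, ← mul_inv, ← pow_add, ← two_mul]
        congr 1
        refine Finset.sum_congr rfl fun y _ => Finset.sum_congr rfl fun z _ => ?_
        rw [sub_eq_add_neg, br_add_right, br_neg_right, AddChar.map_add_eq_mul, Units.val_mul]
        ring
    _ = ((Fintype.card k : ℂ) ^ (2 * n))⁻¹ * ∑ y, ∑ z,
          (∑ η, (ψ (br η (y - z)) : ℂ)) * (g (x, y) * conj (f (x, z))) := by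
        congr 1
        rw [Finset.sum_comm]
        refine Finset.sum_congr rfl fun y _ => ?_
        rw [Finset.sum_comm]
        simp only [Finset.sum_mul]
    _ = ∑ y, g (x, y) * conj (f (x, y)) := by
        simp only [sum_char_br hψ, sub_eq_zero, ite_mul, zero_mul, Finset.sum_ite_eq,
          Finset.mem_univ, if_true]
        rw [← Finset.mul_sum, inv_mul_cancel_left₀ (pow_ne_zero _ hq)]

/-- The partial Fourier transform as a unitary operator. -/
def partialFourier {ψ : AddChar k ℂˣ} (hψ : ψ ≠ 1) :
    EuclideanSpace ℂ (VSq k n) ≃ₗᵢ[ℂ] EuclideanSpace ℂ (VSq k n) :=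
  ((partialFourierAux ψ).isometryOfInner (inner_partialFourierAux hψ)).toLinearIsometryEquiv rfl

lemma partialFourier_apply {ψ : AddChar k ℂˣ} (hψ : ψ ≠ 1) (f : EuclideanSpace ℂ (VSq k n))
    (x η : RowVec k n) :
    partialFourier hψ f (x, η) =
      ((Fintype.card k : ℂ) ^ n)⁻¹ * ∑ y, (ψ (br η y) : ℂ) * f (x, y) := rfl

/-- The Weil representation: the permutation representation on `V²`, transported by the partial
Fourier transform. -/
def weilRep {ψ : AddChar k ℂˣ} (hψ : ψ ≠ 1) : UnitaryRep (OGroup k n) (VSq k n) :=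
  (MulAut.conj (partialFourier hψ)⁻¹).toMonoidHom.comp permRep

lemma weilRep_apply_eq {ψ : AddChar k ℂˣ} (hψ : ψ ≠ 1) {T : OGroup k n}
    {f g : EuclideanSpace ℂ (VSq k n)}
    (h : ∀ x η, partialFourier hψ g (x, η) =
      partialFourier hψ f
        (rowMul (x, η) ((T : (Matrix (Fin 2) (Fin 2) (Mat k n))ˣ) : Matrix _ _ _))) :
    weilRep hψ T f = g := by
  change (partialFourier hψ).symm (permRep T (partialFourier hψ f)) = g
  rw [LinearIsometryEquiv.symm_apply_eq]
  ext ⟨x, η⟩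
  rw [permRep_apply, h]

lemma weilRep_hElt {ψ : AddChar k ℂˣ} (hψ : ψ ≠ 1) (t : (Mat k n)ˣ)
    (f : EuclideanSpace ℂ (VSq k n)) :
    weilRep hψ (hElt (tilde k n) (-1) t) f = WithLp.toLp 2 fun p => f (op (t : Mat k n) • p) := by
  refine weilRep_apply_eq hψ fun x η => ?_
  have h : rowMul (x, η) !![(t : Mat k n), 0; 0, ((invUnit (tilde k n) t)⁻¹ : (Mat k n)ˣ)] =
      (x ᵥ* (t : Mat k n), η ᵥ* (((invUnit (tilde k n) t)⁻¹ : (Mat k n)ˣ) : Mat k n)) := by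
    simp [rowMul]
  change _ = partialFourier hψ f (rowMul (x, η) !![(t : Mat k n), 0; 0, _])
  rw [h, partialFourier_apply, partialFourier_apply]
  congr 1
  -- substitute `y ↦ y t` in the sum on the right
  let e : RowVec k n ≃ RowVec k n :=
    { toFun := fun y => y ᵥ* (t : Mat k n)
      invFun := fun y => y ᵥ* ((t⁻¹ : (Mat k n)ˣ) : Mat k n)
      left_inv := fun y => by simp [vecMul_vecMul]
      right_inv := fun y => by simp [vecMul_vecMul] }
  rw [← Equiv.sum_comp e fun y => (ψ (br _ y) : ℂ) * f (x ᵥ* (t : Mat k n), y)]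
  refine Finset.sum_congr rfl fun y _ => ?_
  have hbr : br (η ᵥ* (((invUnit (tilde k n) t)⁻¹ : (Mat k n)ˣ) : Mat k n)) (e y) = br η y := by
    change br _ (y ᵥ* (t : Mat k n)) = _
    rw [br_vecMul_right, vecMul_vecMul]
    have : (((invUnit (tilde k n) t)⁻¹ : (Mat k n)ˣ) : Mat k n) * inv (tilde k n) (t : Mat k n) = 1 :=
      (invUnit (tilde k n) t).inv_mul
    rw [this, vecMul_one]
  rw [hbr]
  rfl

lemma weilRep_uElt {ψ : AddChar k ℂˣ} (hψ : ψ ≠ 1) (s : symm (tilde k n) (-1))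
    (f : EuclideanSpace ℂ (VSq k n)) :
    weilRep hψ (uElt (tilde k n) (-1) s) f =
      WithLp.toLp 2 fun p => (ψ (br (p.1 ᵥ* (s : Mat k n)) p.2) : ℂ) * f p := by
  refine weilRep_apply_eq hψ fun x η => ?_
  have h : rowMul (x, η) !![1, (s : Mat k n); 0, 1] = (x, x ᵥ* (s : Mat k n) + η) := by
    simp [rowMul]
  change _ = partialFourier hψ f (rowMul (x, η) !![1, (s : Mat k n); 0, 1])
  rw [h, partialFourier_apply, partialFourier_apply]
  congr 1
  refine Finset.sum_congr rfl fun y _ => ?_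
  rw [br_add_left, AddChar.map_add_eq_mul, Units.val_mul]
  ring

lemma weilRep_wElt {ψ : AddChar k ℂˣ} (hψ : ψ ≠ 1) (f : EuclideanSpace ℂ (VSq k n)) :
    weilRep hψ (wElt (tilde k n) (-1)) f = WithLp.toLp 2 fun p =>
      ((Fintype.card k : ℂ) ^ (2 * n))⁻¹ *
        ∑ p' : VSq k n, (ψ (br p.1 p'.2 - br p.2 p'.1) : ℂ) * f p' := by
  classical
  have hq : (Fintype.card k : ℂ) ≠ 0 := Nat.cast_ne_zero.mpr Fintype.card_ne_zero
  refine weilRep_apply_eq hψ fun x η => ?_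
  have h : rowMul (x, η) !![0, 1; (sgn (Mat k n) (-1) : Mat k n), 0] = (-η, x) := by
    simp [rowMul, sgn, vecMul_neg]
  change _ = partialFourier hψ f (rowMul (x, η) !![0, 1; (sgn (Mat k n) (-1) : Mat k n), 0])
  rw [h, partialFourier_apply, partialFourier_apply]
  congr 1
  -- the sum over `y` of `ψ([η + v, y])` is concentrated at `v = -η`
  calc ∑ y, (ψ (br η y) : ℂ) * (((Fintype.card k : ℂ) ^ (2 * n))⁻¹ *
        ∑ p' : VSq k n, (ψ (br x p'.2 - br y p'.1) : ℂ) * f p')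
      = ((Fintype.card k : ℂ) ^ (2 * n))⁻¹ * ∑ y, ∑ v, ∑ z,
          (ψ (br (η + v) y) : ℂ) * ((ψ (br x z) : ℂ) * f (v, z)) := by
        rw [Finset.mul_sum]
        refine Finset.sum_congr rfl fun y _ => ?_
        rw [mul_left_comm, Fintype.sum_prod_type, Finset.mul_sum]
        congr 1
        refine Finset.sum_congr rfl fun v _ => ?_
        rw [Finset.mul_sum]
        refine Finset.sum_congr rfl fun z _ => ?_
        rw [br_swap v y, sub_neg_eq_add, br_add_left, AddChar.map_add_eq_mul,
          AddChar.map_add_eq_mul, Units.val_mul, Units.val_mul]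
        ring
    _ = ((Fintype.card k : ℂ) ^ (2 * n))⁻¹ * ∑ v,
          (∑ y, (ψ (br (η + v) y) : ℂ)) * ∑ z, (ψ (br x z) : ℂ) * f (v, z) := by
        congr 1
        rw [Finset.sum_comm]
        simp only [Finset.sum_mul_sum]
    _ = ∑ z, (ψ (br x z) : ℂ) * f (-η, z) := by
        simp only [sum_char_br_right hψ, add_eq_zero_iff_neg_eq, ite_mul, zero_mul,
          Finset.sum_ite_eq, Finset.mem_univ, if_true]
        rw [inv_mul_cancel_left₀ (pow_ne_zero _ hq)]

lemma isGenWeilRep_weilRep {ψ : AddChar k ℂˣ} (hψ : ψ ≠ 1) :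
    IsGenWeilRep (orthData ψ) (weilRep (n := n) hψ) where
  map_h t f p := by
    rw [weilRep_hElt]
    simp [orthData]
  map_u s f p := by
    rw [weilRep_uElt]
    rfl
  map_w f p := by
    rw [weilRep_wElt, orthData_c, op_neg_sgn_smul]
    rfl

end Representation

/-! ### Uniqueness on the subgroup generated by `h_t`, `u_s` and `w` -/

section Uniqueness

variable {A : Type*} [Ring A] {σ : RingInvo A} {ε : ℤˣ} {M : Type*} [AddCommGroup M]
  [Module Aᵐᵒᵖ M] [Fintype M]

lemma IsGenWeilRep.eqOn_bruhatSubgroup {D : Data σ ε M} {ρ ρ' : UnitaryRep (SLstar σ ε) M}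
    (h : IsGenWeilRep D ρ) (h' : IsGenWeilRep D ρ') :
    ∀ g ∈ bruhatSubgroup σ ε, ρ g = ρ' g := by
  refine MonoidHom.eqOn_closure ?_
  rintro _ ((⟨t, rfl⟩ | ⟨s, rfl⟩) | rfl)
  · ext f x
    rw [h.map_h, h'.map_h]
  · ext f x
    rw [h.map_u, h'.map_u]
  · ext f x
    rw [h.map_w, h'.map_w]

end Uniqueness

/-! ### Independence of the character -/

section Independence

variable {k : Type*} [Field k] [Fintype k] {n : ℕ}

lemma exists_eq_mulShift {ψ₁ ψ₂ : AddChar k ℂˣ} (h₁ : ψ₁ ≠ 1) (h₂ : ψ₂ ≠ 1) :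
    ∃ a : kˣ, ∀ x, ψ₂ x = ψ₁ (a * x) := by
  let φ : AddChar k ℂˣ → AddChar k ℂ := (Units.coeHom ℂ).compAddChar
  have hprim : (φ ψ₁).IsPrimitive :=
    (AddChar.IsPrimitive.of_ne_one h₁).compMulHom_of_isPrimitive Units.val_injective
  -- `k` has as many additive characters as elements, so all of them are shifts of `ψ₁`
  have hbij : Function.Bijective (φ ψ₁).mulShift :=
    (Fintype.bijective_iff_injective_and_card _).mpr
      ⟨AddChar.to_mulShift_inj_of_isPrimitive hprim, AddChar.card_eq.symm⟩
  obtain ⟨a, ha⟩ := hbij.2 (φ ψ₂)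
  have hψ (x : k) : ψ₂ x = ψ₁ (a * x) := Units.ext (DFunLike.congr_fun ha x).symm
  have ha0 : a ≠ 0 := by
    rintro rfl
    exact h₂ (DFunLike.ext _ _ fun x => by simp [hψ])
  exact ⟨Units.mk0 a ha0, hψ⟩

/-- Scaling of the second component of `V²`. -/
def scaleSnd (a : kˣ) : VSq k n ≃ VSq k n :=
  (Equiv.refl _).prodCongr (MulAction.toPerm a)

/-- The operator `(Φ f)(x, y) = f(x, a y)`. -/
def dilation (a : kˣ) : EuclideanSpace ℂ (VSq k n) ≃ₗᵢ[ℂ] EuclideanSpace ℂ (VSq k n) :=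
  LinearIsometryEquiv.piLpCongrLeft 2 ℂ ℂ (scaleSnd a).symm

lemma dilation_apply (a : kˣ) (f : EuclideanSpace ℂ (VSq k n)) (p : VSq k n) :
    dilation a f p = f (scaleSnd a p) := rfl

lemma dilation_symm_apply (a : kˣ) (f : EuclideanSpace ℂ (VSq k n)) (p : VSq k n) :
    (dilation a).symm f p = f ((scaleSnd a).symm p) := by
  rw [dilation, LinearIsometryEquiv.piLpCongrLeft_symm]
  rfl

omit [Fintype k] in
lemma scaleSnd_apply (a : kˣ) (p : VSq k n) : scaleSnd a p = (p.1, (a : k) • p.2) := rfl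

lemma isGenWeilRep_conj_dilation {ψ₁ ψ₂ : AddChar k ℂˣ} {a : kˣ} (ha : ∀ x, ψ₂ x = ψ₁ (a * x))
    {ρ : UnitaryRep (OGroup k n) (VSq k n)} (hρ : IsGenWeilRep (orthData ψ₁) ρ) :
    IsGenWeilRep (orthData ψ₂) ((MulAut.conj (dilation a)).toMonoidHom.comp ρ) where
  map_h t f p := by
    change dilation a (ρ _ ((dilation a).symm f)) p = _
    rw [dilation_apply, hρ.map_h, dilation_symm_apply, scaleSnd_apply]
    congr 1
    refine congrArg f ((scaleSnd a).symm_apply_eq.mpr ?_)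
    exact Prod.ext rfl (smul_vecMul (a : k) p.2 (t : Mat k n))
  map_u s f p := by
    change dilation a (ρ _ ((dilation a).symm f)) p = _
    rw [dilation_apply, hρ.map_u, dilation_symm_apply, Equiv.symm_apply_apply]
    simp only [orthData, scaleSnd_apply, br_smul_right, ha]
  map_w f p := by
    change dilation a (ρ _ ((dilation a).symm f)) p = _
    rw [dilation_apply, hρ.map_w, ← Equiv.sum_comp (scaleSnd a)]
    simp only [dilation_symm_apply, Equiv.symm_apply_apply, op_neg_sgn_smul]
    simp only [orthData, scaleSnd_apply, br_smul_right, br_smul_left, ha, mul_sub]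

end Independence

end GenWeil

end

theorem mainTheorem3 (k : Type*) [Field k] [Fintype k]
    (hodd : Odd (Fintype.card k)) (hq : 3 < Fintype.card k) (n : ℕ) :
    -- `SL_~^-(2, M_{2n}(k))` is the split orthogonal group
    Nonempty (GenWeil.SplitOrthogonal k n ≃* GenWeil.OGroup k n) ∧
    -- the data satisfy the axioms
    (∀ ψ : AddChar k ℂˣ, ψ ≠ 1 →
      (GenWeil.orthData (n := n) ψ).Axioms) ∧
    -- the formulas on generators come from a unitary representation of the whole group
    (∀ ψ : AddChar k ℂˣ, ψ ≠ 1 →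
      ∃ ρ : GenWeil.UnitaryRep (GenWeil.OGroup k n) (GenWeil.VSq k n),
        GenWeil.IsGenWeilRep (GenWeil.orthData ψ) ρ) ∧
    -- which they determine on the subgroup generated by the elements `h_t`, `u_s`, `w`
    (∀ ψ : AddChar k ℂˣ, ψ ≠ 1 →
      ∀ ρ ρ' : GenWeil.UnitaryRep (GenWeil.OGroup k n) (GenWeil.VSq k n),
        GenWeil.IsGenWeilRep (GenWeil.orthData ψ) ρ →
        GenWeil.IsGenWeilRep (GenWeil.orthData ψ) ρ' →
        ∀ g ∈ GenWeil.bruhatSubgroup (GenWeil.tilde k n) (-1), ρ g = ρ' g) ∧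
    -- up to isomorphism nothing depends on the character: for the whole group
    (∀ ψ₁ ψ₂ : AddChar k ℂˣ, ψ₁ ≠ 1 → ψ₂ ≠ 1 →
      ∀ ρ₁ : GenWeil.UnitaryRep (GenWeil.OGroup k n) (GenWeil.VSq k n),
        GenWeil.IsGenWeilRep (GenWeil.orthData ψ₁) ρ₁ →
        ∃ ρ₂ : GenWeil.UnitaryRep (GenWeil.OGroup k n) (GenWeil.VSq k n),
          GenWeil.IsGenWeilRep (GenWeil.orthData ψ₂) ρ₂ ∧
          ∃ Φ : EuclideanSpace ℂ (GenWeil.VSq k n) ≃ₗᵢ[ℂ] EuclideanSpace ℂ (GenWeil.VSq k n),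
            ∀ g f, Φ (ρ₁ g f) = ρ₂ g (Φ f)) ∧
    -- and, for any choice of the two representations, on the subgroup generated by `h_t`, `u_s`, `w`
    (∀ ψ₁ ψ₂ : AddChar k ℂˣ, ψ₁ ≠ 1 → ψ₂ ≠ 1 →
      ∀ ρ₁ ρ₂ : GenWeil.UnitaryRep (GenWeil.OGroup k n) (GenWeil.VSq k n),
        GenWeil.IsGenWeilRep (GenWeil.orthData ψ₁) ρ₁ →
        GenWeil.IsGenWeilRep (GenWeil.orthData ψ₂) ρ₂ →
        ∃ Φ : EuclideanSpace ℂ (GenWeil.VSq k n) ≃ₗᵢ[ℂ] EuclideanSpace ℂ (GenWeil.VSq k n),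
          ∀ g ∈ GenWeil.bruhatSubgroup (GenWeil.tilde k n) (-1),
            ∀ f, Φ (ρ₁ g f) = ρ₂ g (Φ f)) := by
  have hconj : ∀ ψ₁ ψ₂ : AddChar k ℂˣ, ψ₁ ≠ 1 → ψ₂ ≠ 1 →
      ∀ ρ₁ : GenWeil.UnitaryRep (GenWeil.OGroup k n) (GenWeil.VSq k n),
        GenWeil.IsGenWeilRep (GenWeil.orthData ψ₁) ρ₁ →
        ∃ ρ₂ : GenWeil.UnitaryRep (GenWeil.OGroup k n) (GenWeil.VSq k n),
          GenWeil.IsGenWeilRep (GenWeil.orthData ψ₂) ρ₂ ∧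
          ∃ Φ : EuclideanSpace ℂ (GenWeil.VSq k n) ≃ₗᵢ[ℂ] EuclideanSpace ℂ (GenWeil.VSq k n),
            ∀ g f, Φ (ρ₁ g f) = ρ₂ g (Φ f) := by
    intro ψ₁ ψ₂ h₁ h₂ ρ₁ hρ₁
    obtain ⟨a, ha⟩ := GenWeil.exists_eq_mulShift h₁ h₂
    refine ⟨_, GenWeil.isGenWeilRep_conj_dilation ha hρ₁, GenWeil.dilation a, fun g f => ?_⟩
    change _ = GenWeil.dilation a (ρ₁ g ((GenWeil.dilation a).symm (GenWeil.dilation a f)))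
    rw [LinearIsometryEquiv.symm_apply_apply]
  refine ⟨GenWeil.nonempty_splitOrthogonal_mulEquiv k n, fun ψ hψ => GenWeil.orthData_axioms hψ,
    fun ψ hψ => ⟨GenWeil.weilRep hψ, GenWeil.isGenWeilRep_weilRep hψ⟩,
    fun ψ _ ρ ρ' h h' => h.eqOn_bruhatSubgroup h', hconj, ?_⟩
  intro ψ₁ ψ₂ h₁ h₂ ρ₁ ρ₂ hρ₁ hρ₂
  obtain ⟨ρ, hρ, Φ, hΦ⟩ := hconj ψ₁ ψ₂ h₁ h₂ ρ₁ hρ₁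
  exact ⟨Φ, fun g hg f => by rw [hΦ, hρ.eqOn_bruhatSubgroup hρ₂ g hg]⟩
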